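/- Let $G$ be a finite median graph, that is, a (nonempty) finite simple graph in which for every triple of vertices $u,v,w$ there is exactly one vertex lying simultaneously on a shortest $u,v$-path, on a shortest $u,w$-path and on a shortest $v,w$-path. For $n\ge 0$ let $Q_n$ be the $n$-cube, whose vertices are the binary strings of length $n$, two being adjacent if they differ in exactly one position; let $\alpha_n(G)$ be the number of induced subgraphs of $G$ isomorphic to $Q_n$, and let $C(G,x)=\sum_{n\ge 0}\alpha_n(G)x^n$ be the cube polynomial of $G$. Let $m$ be the largest $n$ such that $G$ contains $Q_n$ as an induced subgraph. Then there are integers $b_0(G),b_1(G),\dots,b_m(G)$ such that $$C(G,x)=\sum_{i=0}^m b_i(G)(x+1)^i,$$ where $b_0(G)=1$ and $b_i(G)>0$ for each $0\le i\le m$. -/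

import Mathlib

namespace CubePolynomial

/-- The `n`-cube `Q_n`: vertices are the binary strings of length `n`, two of them being adjacent
when they differ in exactly one position. -/
def hypercube (n : ℕ) : SimpleGraph (Fin n → Bool) where
  Adj u v := ∃! i, u i ≠ v i
  symm := ⟨fun u v h => by simpa only [ne_comm] using h⟩
  loopless := ⟨fun u h => by
    obtain ⟨i, hi, -⟩ := h
    exact hi rfl⟩

/-- The vertex `x` lies on some shortest `u,v`-path of `G`. In particular `u` and `v` are then
joined by a path. -/
def LiesOnShortestPath {V : Type*} (G : SimpleGraph V) (x u v : V) : Prop :=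
  ∃ p : G.Walk u v, p.IsPath ∧ p.length = G.dist u v ∧ x ∈ p.support

/-- `x` is a median of the triple `u, v, w`. -/
def IsMedian {V : Type*} (G : SimpleGraph V) (u v w x : V) : Prop :=
  LiesOnShortestPath G x u v ∧ LiesOnShortestPath G x u w ∧ LiesOnShortestPath G x v w

/-- A median graph: every triple of vertices has a unique median. -/
def IsMedianGraph {V : Type*} (G : SimpleGraph V) : Prop :=
  ∀ u v w : V, ∃! x : V, IsMedian G u v w x

/-- `α_n(G)`: the number of induced subgraphs of `G` isomorphic to `Q_n`; an induced subgraph is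
given by its vertex set. -/
noncomputable def cubeCount {V : Type*} (G : SimpleGraph V) (n : ℕ) : ℕ :=
  {S : Set V | Nonempty (G.induce S ≃g hypercube n)}.ncard

/-- The cube polynomial `C(G, x) = ∑_{i ≥ 0} α_i(G) x ^ i` of a finite graph. The sum may be
stopped at the number of vertices, see `coeff_cubePoly`. -/
noncomputable def cubePoly {V : Type*} (G : SimpleGraph V) : Polynomial ℤ :=
  ∑ i ∈ Finset.range (Nat.card V), Polynomial.monomial i (cubeCount G i : ℤ)

theorem cubeCount_eq_zero {V : Type*} [Finite V] (G : SimpleGraph V) {n : ℕ}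
    (h : Nat.card V ≤ n) : cubeCount G n = 0 := by
  have : {S : Set V | Nonempty (G.induce S ≃g hypercube n)} = ∅ := by
    ext S
    simp only [Set.mem_ofPred_eq, Set.mem_empty_iff_false, iff_false]
    rintro ⟨e⟩
    have h1 : Nat.card S = 2 ^ n := by
      rw [Nat.card_congr e.toEquiv]
      simp
    have h2 : Nat.card S ≤ Nat.card V :=
      Nat.card_le_card_of_injective _ Subtype.val_injective
    have h3 : n < 2 ^ n := Nat.lt_two_pow_self
    omega
  simp [cubeCount, this]

theorem coeff_cubePoly {V : Type*} [Finite V] (G : SimpleGraph V) (n : ℕ) :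
    (cubePoly G).coeff n = cubeCount G n := by
  simp only [cubePoly, Polynomial.finsetSum_coeff, Polynomial.coeff_monomial,
    Finset.sum_ite_eq', Finset.mem_range]
  split_ifs with h
  · rfl
  · rw [cubeCount_eq_zero G (not_lt.mp h)]
    rfl

end CubePolynomial

/-! Fix a base vertex `o` and let d(v) be the number of neighbours of v closer to `o` (`down`). An
induced cube has a unique vertex v farthest from `o`; its neighbours in the cube are lower
neighbours of v and determine the cube (`exists_cubeSet_eq`, `cubeSet_injective`). Conversely, every
set of lower neighbours of v spans an induced cube (`exists_embedding`), built from meets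
(`exists_isMeet`). So α_n(G) is the sum of binomials (d(v) choose n), and C(G,x) is the sum of
(x+1)^d(v) over the vertices: b_i counts the vertices with d(v) = i. Only `o` has d = 0, and d ≤ m
because `down` itself spans a cube. The top v of an m-cube has d(v) ≥ m. Stepping to a lower
neighbour decreases d by at most one (`card_down_le_succ`), so descending from v to `o` meets every
value up to m. -/

namespace CubePolynomial

open SimpleGraph

variable {V : Type*} {G : SimpleGraph V}

/-! ### Betweenness and medians. -/

/-- `x` lies in the metric interval between `u` and `v`. -/
def Between (G : SimpleGraph V) (u x v : V) : Prop :=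
  G.dist u x + G.dist x v = G.dist u v

theorem LiesOnShortestPath.between {x u v : V} (h : LiesOnShortestPath G x u v) :
    Between G u x v := by
  classical
  obtain ⟨p, -, hp, hx⟩ := h
  have h1 := dist_le (p.takeUntil x hx)
  have h2 := dist_le (p.dropUntil x hx)
  have h3 := congrArg Walk.length (p.take_spec hx)
  rw [Walk.length_append] at h3
  have h4 := (p.takeUntil x hx).reachable.dist_triangle_left v
  unfold Between
  omega

theorem Between.liesOnShortestPath (hc : G.Connected) {x u v : V} (h : Between G u x v) :
    LiesOnShortestPath G x u v := by
  obtain ⟨p, hp⟩ := hc.exists_walk_length_eq_dist u x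
  obtain ⟨q, hq⟩ := hc.exists_walk_length_eq_dist x v
  have hl : (p.append q).length = G.dist u v := by
    rw [Walk.length_append, hp, hq]
    exact h
  exact ⟨p.append q, Walk.isPath_of_length_eq_dist _ hl, hl, by simp⟩

theorem Between.symm {u x v : V} (h : Between G u x v) : Between G v x u := by
  unfold Between at *
  rw [dist_comm (u := v) (v := x), dist_comm (u := x) (v := u), dist_comm (u := v) (v := u)]
  omega

/-- A connected graph in which every triple of vertices has exactly one vertex lying between each
two of them. -/
structure MetricMedian (G : SimpleGraph V) : Prop where
  connected : G.Connected
  exists_median : ∀ u v w, ∃ x, Between G u x v ∧ Between G u x w ∧ Between G v x w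
  median_unique : ∀ {u v w x y}, Between G u x v → Between G u x w → Between G v x w →
    Between G u y v → Between G u y w → Between G v y w → x = y

theorem IsMedianGraph.metricMedian [Nonempty V] (hG : IsMedianGraph G) : MetricMedian G := by
  have hc : G.Connected := by
    refine ⟨fun u v => ?_⟩
    -- A median of u, v, v comes with a walk from u to v, so existence of medians forces
    -- connectedness.
    obtain ⟨x, ⟨⟨p, -⟩, -⟩, -⟩ := hG u v v
    exact p.reachable
  refine ⟨hc, fun u v w => ?_, fun {u v w x y} h1 h2 h3 h4 h5 h6 => ?_⟩
  · obtain ⟨x, ⟨h1, h2, h3⟩, -⟩ := hG u v w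
    exact ⟨x, h1.between, h2.between, h3.between⟩
  · exact (hG u v w).unique
      ⟨h1.liesOnShortestPath hc, h2.liesOnShortestPath hc, h3.liesOnShortestPath hc⟩
      ⟨h4.liesOnShortestPath hc, h5.liesOnShortestPath hc, h6.liesOnShortestPath hc⟩

namespace MetricMedian

theorem eq_of_dist (hG : MetricMedian G) {u v : V} (h : G.dist u v = 0) : u = v :=
  hG.connected.dist_eq_zero_iff.mp h

/-- Adjacent vertices have distances from a base vertex that differ by exactly one. -/
theorem dist_adj (hG : MetricMedian G) (o : V) {u v : V} (h : G.Adj u v) :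
    G.dist o u + 1 = G.dist o v ∨ G.dist o v + 1 = G.dist o u := by
  obtain ⟨x, h1, h2, h3⟩ := hG.exists_median o u v
  have h4 : G.dist u v = 1 := dist_eq_one_iff_adj.mpr h
  unfold Between at *
  have h5 : G.dist u x = G.dist x u := dist_comm
  rcases Nat.eq_zero_or_pos (G.dist u x) with h0 | h0
  · obtain rfl := hG.eq_of_dist h0
    omega
  · have h0 : G.dist x v = 0 := by omega
    obtain rfl := hG.eq_of_dist h0
    omega

/-- The meet of two elements for the order based at `v`. -/
theorem between_median (hG : MetricMedian G) {v x z y b : V} (h1 : Between G v y x)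
    (h2 : Between G v y z) (h3 : Between G x y z) (hx : Between G v b x) (hz : Between G v b z) :
    Between G v b y := by
  -- Since b lies between v and both x and z, a median of b, x, z is also one of v, x, z.
  obtain ⟨y', k1, k2, k3⟩ := hG.exists_median b x z
  have t1 := hG.connected.dist_triangle (u := v) (v := b) (w := y')
  have t2 := hG.connected.dist_triangle (u := v) (v := y') (w := x)
  have t3 := hG.connected.dist_triangle (u := v) (v := y') (w := z)
  have : y = y' := by
    apply hG.median_unique h1 h2 h3 _ _ k3 <;> unfold Between at * <;> omega
  subst this
  unfold Between at *
  omega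

/-- Distance 1 is excluded because a and b are equidistant from v, which adjacent vertices never
are. -/
theorem dist_eq_two (hG : MetricMedian G) {v a b : V} (ha : G.Adj v a) (hb : G.Adj v b)
    (hne : a ≠ b) : G.dist a b = 2 := by
  have t := hG.connected.dist_triangle (u := a) (v := v) (w := b)
  have e1 : G.dist a v = 1 := dist_eq_one_iff_adj.mpr ha.symm
  have e2 : G.dist v b = 1 := dist_eq_one_iff_adj.mpr hb
  have e3 : G.dist v a = 1 := dist_eq_one_iff_adj.mpr ha
  have h0 : G.dist a b ≠ 0 := fun h => hne (hG.eq_of_dist h)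
  have h1' : G.dist a b ≠ 1 := fun h => by
    have := hG.dist_adj v (dist_eq_one_iff_adj.mp h)
    omega
  omega

theorem between_of_adj (hG : MetricMedian G) {v a b : V} (ha : G.Adj v a) (hb : G.Adj v b)
    (hne : a ≠ b) : Between G a v b := by
  have e1 : G.dist a v = 1 := dist_eq_one_iff_adj.mpr ha.symm
  have e2 : G.dist v b = 1 := dist_eq_one_iff_adj.mpr hb
  rw [Between, hG.dist_eq_two ha hb hne, e1, e2]

/-- Median graphs contain no `K_{2,3}`. -/
theorem eq_of_adj_three (hG : MetricMedian G) {v c a₁ a₂ a₃ : V} (h12 : a₁ ≠ a₂) (h13 : a₁ ≠ a₃)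
    (h23 : a₂ ≠ a₃) (v1 : G.Adj v a₁) (v2 : G.Adj v a₂) (v3 : G.Adj v a₃) (c1 : G.Adj c a₁)
    (c2 : G.Adj c a₂) (c3 : G.Adj c a₃) : v = c :=
  hG.median_unique (hG.between_of_adj v1 v2 h12) (hG.between_of_adj v1 v3 h13)
    (hG.between_of_adj v2 v3 h23) (hG.between_of_adj c1 c2 h12) (hG.between_of_adj c1 c3 h13)
    (hG.between_of_adj c2 c3 h23)

/-! ### Lower neighbours and the numbers d(v). -/

section Down

variable [Fintype V]

open Classical in
/-- The neighbours of `v` that are closer to the base vertex `o`. -/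
noncomputable def down (G : SimpleGraph V) (o v : V) : Finset V :=
  Finset.univ.filter fun b => G.Adj v b ∧ G.dist o b + 1 = G.dist o v

theorem mem_down {o v b : V} : b ∈ down G o v ↔ G.Adj v b ∧ G.dist o b + 1 = G.dist o v := by
  simp [down]

/-- Two neighbours of `v` closer to `o` have a common neighbour still closer to `o`. -/
theorem exists_down_inter (hG : MetricMedian G) {o v w b : V} (hw : w ∈ down G o v)
    (hb : b ∈ down G o v) (hne : b ≠ w) : ∃ c, c ∈ down G o w ∧ c ∈ down G o b := by
  rw [mem_down] at hw hb
  obtain ⟨c, h1, h2, h3⟩ := hG.exists_median o w b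
  have h0 := hG.dist_eq_two hw.1 hb.1 hne.symm
  have s : G.dist w c = G.dist c w := dist_comm
  unfold Between at *
  have a1 : G.dist w c = 1 := by omega
  have a2 : G.dist b c = 1 := by rw [dist_comm]; omega
  refine ⟨c, ?_, ?_⟩ <;> rw [mem_down]
  · exact ⟨dist_eq_one_iff_adj.mp a1, by omega⟩
  · exact ⟨dist_eq_one_iff_adj.mp a2, by omega⟩

/-- A family of meets of `w` with the other lower neighbours of `v`. -/
theorem exists_injOn_down (hG : MetricMedian G) {o v w : V} (hw : w ∈ down G o v) :
    ∃ f : V → V, (∀ b ∈ down G o v, b ≠ w → f b ∈ down G o w ∧ f b ∈ down G o b) ∧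
      Set.InjOn f {b | b ∈ down G o v ∧ b ≠ w} := by
  have h : ∀ b, ∃ c, b ∈ down G o v → b ≠ w → c ∈ down G o w ∧ c ∈ down G o b := fun b => by
    by_cases hb : b ∈ down G o v ∧ b ≠ w
    · obtain ⟨c, hc⟩ := hG.exists_down_inter hw hb.1 hb.2
      exact ⟨c, fun _ _ => hc⟩
    · exact ⟨b, fun h1 h2 => (hb ⟨h1, h2⟩).elim⟩
  choose f hf using h
  refine ⟨f, hf, fun b hb b' hb' he => ?_⟩
  by_contra hne
  obtain ⟨h1, h2⟩ := hf b hb.1 hb.2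
  obtain ⟨-, h3⟩ := hf b' hb'.1 hb'.2
  rw [← he] at h3
  have hb1 := hb.1
  have hb1' := hb'.1
  rw [mem_down] at h1 h2 h3 hb1 hb1' hw
  -- If f b = f b', then v and f b share the three neighbours w, b, b'.
  have : v = f b := hG.eq_of_adj_three hb.2.symm hb'.2.symm hne hw.1 hb1.1 hb1'.1 h1.1.symm
    h2.1.symm h3.1.symm
  have := congrArg (G.dist o) this
  omega

theorem card_down_le_succ (hG : MetricMedian G) {o v w : V} (hw : w ∈ down G o v) :
    (down G o v).card ≤ (down G o w).card + 1 := by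
  classical
  obtain ⟨f, hf, hinj⟩ := hG.exists_injOn_down hw
  have : ((down G o v).erase w).card ≤ (down G o w).card := by
    refine Finset.card_le_card_of_injOn f (fun b hb => ?_) (hinj.mono fun b hb => ?_)
    · have := Finset.mem_erase.mp hb
      exact (hf b this.2 this.1).1
    · have := Finset.mem_erase.mp hb
      exact ⟨this.2, this.1⟩
  rw [Finset.card_erase_of_mem hw] at this
  omega

theorem card_down_le_dist (hG : MetricMedian G) (o v : V) :
    (down G o v).card ≤ G.dist o v := by
  induction h : G.dist o v generalizing v with
  | zero =>
    rw [Nat.le_zero, Finset.card_eq_zero, Finset.eq_empty_iff_forall_notMem]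
    intro b hb
    have := (mem_down.mp hb).2
    omega
  | succ k ih =>
    rcases (down G o v).eq_empty_or_nonempty with he | ⟨w, hw⟩
    · simp [he]
    · have h1 := hG.card_down_le_succ hw
      have h2 := ih w (by have := (mem_down.mp hw).2; omega)
      omega

theorem down_nonempty (hG : MetricMedian G) {o v : V} (h : v ≠ o) : (down G o v).Nonempty := by
  obtain ⟨p, hp⟩ := hG.connected.exists_walk_length_eq_dist v o
  cases p with
  | nil => exact (h rfl).elim
  | @cons _ w _ a q =>
    refine ⟨w, mem_down.mpr ⟨a, ?_⟩⟩
    have h1 := dist_le q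
    rw [Walk.length_cons] at hp
    have h2 := hG.dist_adj o a
    have e1 : G.dist o w = G.dist w o := dist_comm
    have e2 : G.dist o v = G.dist v o := dist_comm
    omega

/-- The numbers of lower neighbours take all values up to the one at `v`. -/
theorem exists_card_down_eq (hG : MetricMedian G) (o v : V) {i : ℕ}
    (hi : i ≤ (down G o v).card) : ∃ w, (down G o w).card = i := by
  induction h : G.dist o v generalizing v with
  | zero =>
    have := hG.card_down_le_dist o v
    exact ⟨v, by omega⟩
  | succ k ih =>
    rcases hi.eq_or_lt with he | hlt
    · exact ⟨v, he.symm⟩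
    · obtain ⟨w, hw⟩ := Finset.card_pos.mp (by omega : 0 < (down G o v).card)
      have h1 := hG.card_down_le_succ hw
      exact ih w (by omega) (by have := (mem_down.mp hw).2; omega)

/-! ### Meets of sets of lower neighbours. -/

/-- `x` is the vertex below `v` at distance `#B` whose interval to `v` contains `B`. -/
structure IsMeet (G : SimpleGraph V) (o v : V) (B : Finset V) (x : V) : Prop where
  between : Between G o x v
  dist_eq : G.dist v x = B.card
  between_of_mem : ∀ b ∈ B, Between G v b x

/-- With y as the base vertex, B consists of lower neighbours of v, so `card_down_le_dist` applies.
-/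
theorem card_le_dist (hG : MetricMedian G) {v y : V} {B : Finset V} (hB : ∀ b ∈ B, G.Adj v b)
    (h : ∀ b ∈ B, Between G v b y) : B.card ≤ G.dist v y := by
  rw [dist_comm]
  refine le_trans (Finset.card_le_card fun b hb => mem_down.mpr ⟨hB b hb, ?_⟩)
    (hG.card_down_le_dist y v)
  have h1 := (h b hb).symm
  rw [Between, dist_comm (u := b), dist_eq_one_iff_adj.mpr (hB b hb)] at h1
  exact h1

/-- The median of v, x, z still has B in its interval to v, hence is at distance at least #B from v,
which leaves only x. -/
theorem IsMeet.between_of_forall (hG : MetricMedian G) {o v x z : V} {B : Finset V}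
    (hx : IsMeet G o v B x) (hB : ∀ b ∈ B, G.Adj v b) (h : ∀ b ∈ B, Between G v b z) :
    Between G v x z := by
  obtain ⟨y, h1, h2, h3⟩ := hG.exists_median v x z
  have h4 := hG.card_le_dist hB fun b hb =>
    hG.between_median h1 h2 h3 (hx.between_of_mem b hb) (h b hb)
  have h5 := hx.dist_eq
  have : G.dist y x = 0 := by
    unfold Between at h1
    omega
  rwa [hG.eq_of_dist this] at h2

theorem IsMeet.unique (hG : MetricMedian G) {o v x z : V} {B : Finset V}
    (hx : IsMeet G o v B x) (hz : IsMeet G o v B z) (hB : ∀ b ∈ B, G.Adj v b) : x = z := by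
  have h := hx.between_of_forall hG hB hz.between_of_mem
  rw [Between, hx.dist_eq, hz.dist_eq] at h
  exact hG.eq_of_dist (by omega)

theorem exists_isMeet (hG : MetricMedian G) {o v : V} {B : Finset V} (hB : B ⊆ down G o v) :
    ∃ x, IsMeet G o v B x := by
  classical
  induction h : B.card generalizing v B with
  | zero =>
    rw [Finset.card_eq_zero] at h
    subst h
    exact ⟨v, by simp [Between], by simp, by simp⟩
  | succ k ih =>
    obtain ⟨w, hw⟩ := Finset.card_pos.mp (by omega : 0 < B.card)
    obtain ⟨f, hf, hinj⟩ := hG.exists_injOn_down (hB hw)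
    have hmem : ∀ b ∈ B.erase w, b ∈ down G o v ∧ b ≠ w := fun b hb =>
      ⟨hB (Finset.mem_of_mem_erase hb), Finset.ne_of_mem_erase hb⟩
    have hcard : ((B.erase w).image f).card = k := by
      rw [Finset.card_image_of_injOn (hinj.mono hmem), Finset.card_erase_of_mem hw, h]
      rfl
    -- The meet of B at v is the meet, at w, of the lower neighbours of w lying below the other
    -- elements of B.
    obtain ⟨x, hx⟩ := ih (v := w) (B := (B.erase w).image f) (by
      intro c hc
      obtain ⟨b, hb, rfl⟩ := Finset.mem_image.mp hc
      exact (hf b (hmem b hb).1 (hmem b hb).2).1) hcard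
    have hwd := mem_down.mp (hB hw)
    have e1 : G.dist v w = 1 := dist_eq_one_iff_adj.mpr hwd.1
    have hb1 := hx.between
    have hd1 := hx.dist_eq
    rw [hcard] at hd1
    have e2 : G.dist x w = G.dist w x := dist_comm
    have e3 : G.dist x v = G.dist v x := dist_comm
    have t1 := hG.connected.dist_triangle (u := v) (v := w) (w := x)
    have t2 := hG.connected.dist_triangle (u := o) (v := x) (w := v)
    unfold Between at hb1
    refine ⟨x, ?_, by omega, fun b hb => ?_⟩
    · unfold Between
      omega
    · unfold Between
      by_cases hbw : b = w
      · subst hbw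
        omega
      · have hbe : b ∈ B.erase w := Finset.mem_erase.mpr ⟨hbw, hb⟩
        obtain ⟨h1, h2⟩ := hf b (hB hb) hbw
        rw [mem_down] at h1 h2
        have h3 := hx.between_of_mem _ (Finset.mem_image_of_mem f hbe)
        unfold Between at h3
        have e4 : G.dist w (f b) = 1 := dist_eq_one_iff_adj.mpr h1.1
        have e5 : G.dist b (f b) = 1 := dist_eq_one_iff_adj.mpr h2.1
        have e6 : G.dist v b = 1 := dist_eq_one_iff_adj.mpr (mem_down.mp (hB hb)).1
        have t3 := hG.connected.dist_triangle (u := b) (v := f b) (w := x)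
        have t4 := hG.connected.dist_triangle (u := v) (v := b) (w := x)
        omega

end Down

end MetricMedian

/-! ### Cubes indexed by finite sets. -/

/-- The set of positions at which a binary string is `true`. -/
def trueSet {n : ℕ} (s : Fin n → Bool) : Finset (Fin n) := Finset.univ.filter fun i => s i = true

theorem mem_trueSet {n : ℕ} {s : Fin n → Bool} {i : Fin n} : i ∈ trueSet s ↔ s i = true := by
  simp [trueSet]

theorem trueSet_injective {n : ℕ} : Function.Injective (trueSet (n := n)) := fun s t h => by
  funext i
  have := congrArg (i ∈ ·) h
  simpa [mem_trueSet] using this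

theorem hypercube_adj_iff {n : ℕ} {s t : Fin n → Bool} : (hypercube n).Adj s t ↔
    ∃ i, (i ∉ trueSet s ∧ trueSet t = insert i (trueSet s)) ∨
      (i ∉ trueSet t ∧ trueSet s = insert i (trueSet t)) := by
  constructor
  · rintro ⟨i, hi, hu⟩
    have hu' : ∀ j, j ≠ i → s j = t j := fun j hj => by
      by_contra h
      exact hj (hu j h)
    refine ⟨i, ?_⟩
    cases hs : s i
    · left
      have ht : t i = true := by
        cases h : t i <;> simp_all
      refine ⟨by simp [mem_trueSet, hs], ?_⟩
      ext j
      rw [Finset.mem_insert, mem_trueSet, mem_trueSet]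
      by_cases hj : j = i
      · simp [hj, ht]
      · simp [hj, hu' j hj]
    · right
      have ht : t i = false := by
        cases h : t i <;> simp_all
      refine ⟨by simp [mem_trueSet, ht], ?_⟩
      ext j
      rw [Finset.mem_insert, mem_trueSet, mem_trueSet]
      by_cases hj : j = i
      · simp [hj, hs]
      · simp [hj, hu' j hj]
  · have key : ∀ s t : Fin n → Bool, ∀ i, i ∉ trueSet s → trueSet t = insert i (trueSet s) →
        (hypercube n).Adj s t := fun s t i hi h => by
      have h' : ∀ j, t j = true ↔ j = i ∨ s j = true := fun j => by
        rw [← mem_trueSet, h, Finset.mem_insert, mem_trueSet]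
      rw [mem_trueSet] at hi
      refine ⟨i, fun he => hi (he.trans ((h' i).mpr (Or.inl rfl))), fun j hj => ?_⟩
      by_contra hne
      refine hj (Bool.eq_iff_iff.mpr ?_)
      rw [h' j]
      simp [hne]
    rintro ⟨i, ⟨hi, h⟩ | ⟨hi, h⟩⟩
    · exact key s t i hi h
    · exact (key t s i hi h).symm

/-- An induced cube through `v` may be indexed by finite sets, with `v` indexed by `∅`. -/
theorem exists_indexing {n : ℕ} {S : Set V} (e : G.induce S ≃g hypercube n) {v : V} (hv : v ∈ S) :
    ∃ g : Finset (Fin n) → V, Function.Injective g ∧ Set.range g = S ∧ g ∅ = v ∧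
      ∀ B i, i ∉ B → G.Adj (g B) (g (insert i B)) := by
  set c := e ⟨v, hv⟩ with hc
  -- Translation by the coordinates of v is an automorphism of the cube that moves v to the index ∅.
  let s : Finset (Fin n) → Fin n → Bool := fun B i => xor (decide (i ∈ B)) (c i)
  have hs : Function.Injective s := fun B B' h => by
    ext i
    have := congrFun h i
    simpa [s] using this
  refine ⟨fun B => (e.symm (s B)).1, fun B B' h => hs (e.symm.injective (Subtype.ext h)), ?_, ?_,
    fun B i hi => ?_⟩
  · ext x
    constructor
    · rintro ⟨B, rfl⟩
      exact (e.symm (s B)).2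
    · intro hx
      refine ⟨Finset.univ.filter fun i => e ⟨x, hx⟩ i ≠ c i, ?_⟩
      have : s (Finset.univ.filter fun i => e ⟨x, hx⟩ i ≠ c i) = e ⟨x, hx⟩ := by
        funext i
        simp only [s, Finset.mem_filter, Finset.mem_univ, true_and]
        cases e ⟨x, hx⟩ i <;> cases c i <;> rfl
      simp only [this, e.symm_apply_apply]
  · have : s ∅ = c := by
      funext i
      simp [s]
    simp only [this, hc, e.symm_apply_apply]
  · have h : (hypercube n).Adj (s B) (s (insert i B)) := by
      refine ⟨i, by simp [s, hi], fun j hj => ?_⟩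
      by_contra hne
      simp [s, hne] at hj
    exact e.symm.map_rel_iff.mpr h

/-! ### Induced cubes seen from their farthest vertex. -/

namespace MetricMedian

theorem IsMeet.dist_add_card {o v x : V} {B : Finset V} (h : IsMeet G o v B x) :
    G.dist o x + B.card = G.dist o v := by
  rw [← h.between, ← h.dist_eq, dist_comm (u := v)]

/-- In a cube whose farthest vertex is indexed by `∅`, the distance from the base vertex drops by
the size of the index. -/
theorem dist_add_card_of_indexing (hG : MetricMedian G) {o : V} {n : ℕ} {g : Finset (Fin n) → V}
    (hinj : Function.Injective g) (hadj : ∀ B i, i ∉ B → G.Adj (g B) (g (insert i B)))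
    (hmax : ∀ B, G.dist o (g B) ≤ G.dist o (g ∅)) (B : Finset (Fin n)) :
    G.dist o (g B) + B.card = G.dist o (g ∅) := by
  induction h : B.card using Nat.strong_induction_on generalizing B with
  | _ k ih =>
  rcases B.eq_empty_or_nonempty with rfl | ⟨i, hi⟩
  · simp_all
  have hci := Finset.card_erase_of_mem hi
  have hpos := Finset.card_pos.mpr ⟨i, hi⟩
  have ai := hadj (B.erase i) i (Finset.notMem_erase i B)
  rw [Finset.insert_erase hi] at ai
  have ihi := ih _ (by omega) (B.erase i) rfl
  rcases (B.erase i).eq_empty_or_nonempty with he | ⟨j, hj⟩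
  · rw [he] at ai hci
    have := hG.dist_adj o ai
    have := hmax B
    simp at hci
    omega
  obtain ⟨hji, hjB⟩ := Finset.mem_erase.mp hj
  have hcj := Finset.card_erase_of_mem hjB
  have hcij := Finset.card_erase_of_mem hj
  have hposi := Finset.card_pos.mpr ⟨j, hj⟩
  have aj := hadj (B.erase j) j (Finset.notMem_erase j B)
  rw [Finset.insert_erase hjB] at aj
  have ihj := ih _ (by omega) (B.erase j) rfl
  have ihij := ih _ (by omega) ((B.erase i).erase j) rfl
  have aij := hadj ((B.erase i).erase j) j (Finset.notMem_erase j _)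
  rw [Finset.insert_erase hj] at aij
  have hij : i ∈ B.erase j := Finset.mem_erase.mpr ⟨hji.symm, hi⟩
  have aji := hadj ((B.erase j).erase i) i (Finset.notMem_erase i _)
  rw [Finset.insert_erase hij, Finset.erase_right_comm] at aji
  -- If the distance rose from B \ {i} to B, the vertices at B \ {i} and B \ {j} would both be
  -- medians of `o` and the vertices at B \ {i, j} and B.
  rcases hG.dist_adj o ai with h1 | h1
  swap
  · omega
  exfalso
  have hne : g ((B.erase i).erase j) ≠ g B := fun he => by
    have := congrArg Finset.card (hinj he)
    omega
  have b1 := hG.between_of_adj aij.symm ai hne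
  have b2 := hG.between_of_adj aji.symm aj hne
  have dist_one : ∀ {x y : V}, G.Adj x y → G.dist x y = 1 := dist_eq_one_iff_adj.mpr
  have heq : g (B.erase i) = g (B.erase j) := by
    refine hG.median_unique (u := o) ?_ ?_ b1 ?_ ?_ b2 <;> unfold Between
    · rw [dist_one aij.symm]; omega
    · rw [dist_one ai]; omega
    · rw [dist_one aji.symm]; omega
    · rw [dist_one aj]; omega
  have := hinj heq
  rw [this] at hj
  exact Finset.notMem_erase j B hj

theorem dist_union_le (hG : MetricMedian G) {n : ℕ} {g : Finset (Fin n) → V}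
    (hadj : ∀ B i, i ∉ B → G.Adj (g B) (g (insert i B))) (B D : Finset (Fin n)) :
    G.dist (g B) (g (B ∪ D)) ≤ D.card := by
  induction D using Finset.induction_on with
  | empty => simp
  | insert i D hi ih =>
    rw [Finset.card_insert_of_notMem hi, Finset.union_insert]
    by_cases hB : i ∈ B ∪ D
    · rw [Finset.insert_eq_of_mem hB]
      omega
    · have h1 : G.dist (g (B ∪ D)) (g (insert i (B ∪ D))) = 1 :=
        dist_eq_one_iff_adj.mpr (hadj _ i hB)
      have h2 := hG.connected.dist_triangle (u := g B) (v := g (B ∪ D))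
        (w := g (insert i (B ∪ D)))
      omega

open Classical in
theorem isMeet_of_indexing (hG : MetricMedian G) {o : V} {n : ℕ} {g : Finset (Fin n) → V}
    (hinj : Function.Injective g) (hadj : ∀ B i, i ∉ B → G.Adj (g B) (g (insert i B)))
    (hmax : ∀ B, G.dist o (g B) ≤ G.dist o (g ∅)) (B : Finset (Fin n)) :
    IsMeet G o (g ∅) (B.image fun i => g {i}) (g B) := by
  have hcard : (B.image fun i => g {i}).card = B.card :=
    Finset.card_image_of_injective _ (hinj.comp Finset.singleton_injective)
  have h1 := hG.dist_add_card_of_indexing hinj hadj hmax B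
  have h2 := hG.dist_union_le hadj ∅ B
  rw [Finset.empty_union] at h2
  have t1 := hG.connected.dist_triangle (u := o) (v := g B) (w := g ∅)
  have s1 : G.dist (g B) (g ∅) = G.dist (g ∅) (g B) := dist_comm
  refine ⟨?_, ?_, fun b hb => ?_⟩
  · unfold Between
    omega
  · omega
  · obtain ⟨i, hi, rfl⟩ := Finset.mem_image.mp hb
    have h3 := hG.dist_union_le hadj ∅ {i}
    have h4 := hG.dist_union_le hadj {i} (B.erase i)
    have he : {i} ∪ B.erase i = B := Finset.insert_erase hi
    rw [Finset.empty_union, Finset.card_singleton] at h3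
    rw [he, Finset.card_erase_of_mem hi] at h4
    have hpos := Finset.card_pos.mpr ⟨i, hi⟩
    have t2 := hG.connected.dist_triangle (u := g ∅) (v := g {i}) (w := g B)
    unfold Between
    omega

/-! ### Cubes spanned by sets of lower neighbours. -/

variable [Fintype V]

/-- The vertex set of the cube with top vertex `v` spanned by the set `A` of neighbours of `v`. -/
def cubeSet (G : SimpleGraph V) (o v : V) (A : Finset V) : Set V :=
  {x | ∃ B ⊆ A, IsMeet G o v B x}

theorem adj_of_subset_down {o v : V} {A : Finset V} (hA : A ⊆ down G o v) :
    ∀ b ∈ A, G.Adj v b := fun _ hb => (mem_down.mp (hA hb)).1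

/-- All of B ∪ C lies between v and x, so `card_le_dist` gives #(B ∪ C) ≤ #B. -/
theorem IsMeet.subset (hG : MetricMedian G) {o v x : V} {A B C : Finset V}
    (hA : A ⊆ down G o v) (hB : B ⊆ A) (hC : C ⊆ A) (h : IsMeet G o v B x)
    (hx : ∀ c ∈ C, Between G v c x) : C ⊆ B := by
  classical
  have h1 := hG.card_le_dist (y := x) (B := B ∪ C)
    (fun b hb => adj_of_subset_down hA b (Finset.union_subset hB hC hb))
    (fun b hb => (Finset.mem_union.mp hb).elim (h.between_of_mem b) (hx b))
  rw [h.dist_eq] at h1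
  have := Finset.eq_of_subset_of_card_le Finset.subset_union_left h1
  rw [this]
  exact Finset.subset_union_right

theorem IsMeet.adj_iff (hG : MetricMedian G) {o v x y : V} {A B C : Finset V}
    (hA : A ⊆ down G o v) (hB : B ⊆ A) (hC : C ⊆ A) (hx : IsMeet G o v B x)
    (hy : IsMeet G o v C y) (hcard : C.card = B.card + 1) : G.Adj x y ↔ B ⊆ C := by
  have hBadj := adj_of_subset_down (hB.trans hA)
  have e1 := hx.dist_eq
  have e2 := hy.dist_eq
  constructor
  · intro h
    refine hy.subset hG hA hC hB fun b hb => ?_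
    have e3 : G.dist x y = 1 := dist_eq_one_iff_adj.mpr h
    have t1 := hG.connected.dist_triangle (u := b) (v := x) (w := y)
    have t2 := hG.connected.dist_triangle (u := v) (v := b) (w := y)
    have := hx.between_of_mem b hb
    unfold Between at *
    omega
  · intro h
    have := hx.between_of_forall hG hBadj fun b hb => hy.between_of_mem b (h hb)
    unfold Between at this
    exact dist_eq_one_iff_adj.mp (by omega)

/-- A set of lower neighbours of `v` spans an induced cube. -/
theorem exists_embedding (hG : MetricMedian G) {o v : V} {A : Finset V} (hA : A ⊆ down G o v) :
    ∃ f : hypercube A.card ↪g G, Set.range f = cubeSet G o v A := by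
  classical
  let a : Fin A.card ↪ V := A.equivFin.symm.toEmbedding.trans (Function.Embedding.subtype _)
  have ha : ∀ i, a i ∈ A := fun i => (A.equivFin.symm i).2
  have hmap : ∀ s, (trueSet s).map a ⊆ A := fun s b hb => by
    obtain ⟨i, -, rfl⟩ := Finset.mem_map.mp hb
    exact ha i
  choose f hf using fun s : Fin A.card → Bool => hG.exists_isMeet ((hmap s).trans hA)
  have hinj : Function.Injective f := fun s t h => by
    have h1 := (hf s).subset hG hA (hmap s) (hmap t) (h ▸ (hf t).between_of_mem)
    have h2 := (hf t).subset hG hA (hmap t) (hmap s) (h ▸ (hf s).between_of_mem)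
    exact trueSet_injective (Finset.map_injective a (h2.antisymm h1))
  -- Adjacent vertices differ by one in distance from `o`, hence adjacent meets differ by one in the
  -- size of their index; no other case needs comparison.
  have key : ∀ s t, (trueSet t).card = (trueSet s).card + 1 →
      (G.Adj (f s) (f t) ↔ ∃ i, i ∉ trueSet s ∧ trueSet t = insert i (trueSet s)) := fun s t h => by
    rw [(hf s).adj_iff hG hA (hmap s) (hmap t) (hf t) (by simpa using h), Finset.map_subset_map]
    constructor
    · intro hst
      have h1 : (trueSet t \ trueSet s).card = 1 := by
        rw [Finset.card_sdiff_of_subset hst]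
        omega
      obtain ⟨i, hi⟩ := Finset.card_eq_one.mp h1
      have h2 : i ∈ trueSet t \ trueSet s := by simp [hi]
      refine ⟨i, (Finset.mem_sdiff.mp h2).2, ?_⟩
      rw [← Finset.sdiff_union_of_subset hst, hi]
      rfl
    · rintro ⟨i, -, hi⟩
      rw [hi]
      exact Finset.subset_insert _ _
  have hadj : ∀ {s t}, G.Adj (f s) (f t) ↔ (hypercube A.card).Adj s t := by
    intro s t
    rw [hypercube_adj_iff]
    constructor
    · intro h
      have e1 := (hf s).dist_add_card
      have e2 := (hf t).dist_add_card
      rw [Finset.card_map] at e1 e2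
      rcases hG.dist_adj o h with h1 | h1
      · obtain ⟨i, hi⟩ := (key t s (by omega)).mp h.symm
        exact ⟨i, Or.inr hi⟩
      · obtain ⟨i, hi⟩ := (key s t (by omega)).mp h
        exact ⟨i, Or.inl hi⟩
    · rintro ⟨i, ⟨hi, h⟩ | ⟨hi, h⟩⟩
      · exact (key s t (by rw [h, Finset.card_insert_of_notMem hi])).mpr ⟨i, hi, h⟩
      · exact ((key t s (by rw [h, Finset.card_insert_of_notMem hi])).mpr ⟨i, hi, h⟩).symm
  refine ⟨⟨⟨f, hinj⟩, hadj⟩, ?_⟩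
  ext x
  constructor
  · rintro ⟨s, rfl⟩
    exact ⟨_, hmap s, hf s⟩
  · rintro ⟨B, hB, hx⟩
    refine ⟨fun i => decide (a i ∈ B), ?_⟩
    have hs : (trueSet fun i => decide (a i ∈ B)).map a = B := by
      ext b
      rw [Finset.mem_map]
      constructor
      · rintro ⟨i, hi, rfl⟩
        simpa [mem_trueSet] using hi
      · intro hb
        have hab : a (A.equivFin ⟨b, hB hb⟩) = b := by simp [a]
        exact ⟨A.equivFin ⟨b, hB hb⟩, by simpa [mem_trueSet, hab] using hb, hab⟩
    have h1 := hf fun i => decide (a i ∈ B)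
    rw [hs] at h1
    exact h1.unique hG hx (adj_of_subset_down (hB.trans hA))

/-- The top is the vertex of the cube farthest from `o`, and the spanning set is the set of its
neighbours within the cube. -/
theorem cubeSet_injective (hG : MetricMedian G) {o v w : V} {A B : Finset V}
    (hA : A ⊆ down G o v) (hB : B ⊆ down G o w) (h : cubeSet G o v A = cubeSet G o w B) :
    v = w ∧ A = B := by
  have top : ∀ (v : V) (A : Finset V), v ∈ cubeSet G o v A := fun v A =>
    ⟨∅, by simp, by simp [Between], by simp, by simp⟩
  have hv := top v A
  have hw := top w B
  rw [h] at hv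
  rw [← h] at hw
  obtain ⟨C, -, hC⟩ := hv
  obtain ⟨D, -, hD⟩ := hw
  have e1 := hC.dist_add_card
  have e2 := hD.dist_add_card
  have e3 := hC.dist_eq
  obtain rfl : w = v := hG.eq_of_dist (by omega)
  have mem : ∀ A : Finset V, A ⊆ down G o w → ∀ b, b ∈ A ↔ b ∈ cubeSet G o w A ∧ G.Adj w b := by
    intro A hA b
    constructor
    · intro hb
      have hd := mem_down.mp (hA hb)
      have e4 : G.dist w b = 1 := dist_eq_one_iff_adj.mpr hd.1
      refine ⟨⟨{b}, by simpa using hb, ?_, by simpa using hd.1, ?_⟩, hd.1⟩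
      · rw [Between, dist_comm (u := b), e4, hd.2]
      · simp [Between]
    · rintro ⟨⟨C, hC, hb⟩, hadj⟩
      have e4 := hb.dist_eq
      rw [dist_eq_one_iff_adj.mpr hadj] at e4
      obtain ⟨c, rfl⟩ := Finset.card_eq_one.mp e4.symm
      have hc : c ∈ A := hC (by simp)
      have e5 := hb.between_of_mem c (by simp)
      rw [Between, dist_eq_one_iff_adj.mpr hadj,
        dist_eq_one_iff_adj.mpr (adj_of_subset_down hA c hc)] at e5
      rwa [← hG.eq_of_dist (by omega : G.dist c b = 0)]
  refine ⟨rfl, ?_⟩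
  ext b
  rw [mem A hA, mem B hB, h]

/-- Every induced cube is spanned by lower neighbours of its farthest vertex. -/
theorem exists_cubeSet_eq (hG : MetricMedian G) (o : V) {n : ℕ} {S : Set V}
    (e : G.induce S ≃g hypercube n) :
    ∃ v A, A ⊆ down G o v ∧ A.card = n ∧ cubeSet G o v A = S := by
  classical
  have hne : S.Nonempty := ⟨_, (e.symm fun _ => false).2⟩
  obtain ⟨v, hv, hvmax⟩ := Set.exists_max_image S (G.dist o) S.toFinite hne
  obtain ⟨g, hinj, hrange, rfl, hadj⟩ := exists_indexing e hv
  have hmax : ∀ B, G.dist o (g B) ≤ G.dist o (g ∅) := fun B =>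
    hvmax _ (hrange ▸ Set.mem_range_self B)
  have hmeet := hG.isMeet_of_indexing hinj hadj hmax
  have hA : (Finset.univ.image fun i => g {i}) ⊆ down G o (g ∅) := fun b hb => by
    obtain ⟨i, -, rfl⟩ := Finset.mem_image.mp hb
    refine mem_down.mpr ⟨hadj ∅ i (by simp), ?_⟩
    simpa using hG.dist_add_card_of_indexing hinj hadj hmax {i}
  refine ⟨g ∅, Finset.univ.image fun i => g {i}, hA, ?_, ?_⟩
  · exact (Finset.card_image_of_injective _ (hinj.comp Finset.singleton_injective)).trans
      (Finset.card_fin n)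
  · rw [← hrange]
    ext x
    constructor
    · rintro ⟨C, hC, hx⟩
      obtain ⟨B, -, rfl⟩ := Finset.subset_image_iff.mp hC
      exact ⟨B, (hmeet B).unique hG hx (adj_of_subset_down (hC.trans hA))⟩
    · rintro ⟨B, rfl⟩
      exact ⟨_, Finset.image_subset_image (Finset.subset_univ B), hmeet B⟩

/-! ### Counting cubes by their top vertex. -/

theorem cubeCount_eq_sum (hG : MetricMedian G) (o : V) (n : ℕ) :
    cubeCount G n = ∑ v, (down G o v).card.choose n := by
  classical
  have hset : {S : Set V | Nonempty (G.induce S ≃g hypercube n)} =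
      (fun p : (_ : V) × Finset V => cubeSet G o p.1 p.2) ''
        (Finset.univ.sigma fun v => (down G o v).powersetCard n) := by
    ext S
    simp only [Set.mem_ofPred_eq, Set.mem_image, Finset.mem_coe, Finset.mem_sigma,
      Finset.mem_univ, true_and, Finset.mem_powersetCard]
    constructor
    · rintro ⟨e⟩
      obtain ⟨v, A, hA, hn, hS⟩ := hG.exists_cubeSet_eq o e
      exact ⟨⟨v, A⟩, ⟨hA, hn⟩, hS⟩
    · rintro ⟨⟨v, A⟩, ⟨hA, rfl⟩, rfl⟩
      obtain ⟨f, hf⟩ := hG.exists_embedding hA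
      dsimp only
      rw [← hf]
      exact ⟨f.isoInduceRange.symm⟩
  rw [cubeCount, hset, Set.InjOn.ncard_image, Set.ncard_coe_finset, Finset.card_sigma]
  · simp
  · rintro ⟨v, A⟩ hA ⟨w, B⟩ hB h
    simp only [Finset.mem_coe, Finset.mem_sigma, Finset.mem_univ, true_and,
      Finset.mem_powersetCard] at hA hB
    obtain ⟨rfl, rfl⟩ := hG.cubeSet_injective hA.1 hB.1 h
    rfl

theorem cubePoly_eq_sum (hG : MetricMedian G) (o : V) :
    cubePoly G = ∑ v, (Polynomial.X + 1) ^ (down G o v).card := by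
  ext n
  rw [coeff_cubePoly, hG.cubeCount_eq_sum o, Polynomial.finsetSum_coeff]
  simp [Polynomial.coeff_X_add_one_pow]

end MetricMedian

end CubePolynomial

theorem theorem4p9 {V : Type*} [Finite V] (G : SimpleGraph V)
    (hG : CubePolynomial.IsMedianGraph G) (m : ℕ)
    (hm : IsGreatest {n : ℕ | (CubePolynomial.hypercube n).IsIndContained G} m) :
    ∃ b : ℕ → ℤ,
      CubePolynomial.cubePoly G =
        ∑ i ∈ Finset.range (m + 1), Polynomial.C (b i) * (Polynomial.X + 1) ^ i ∧
      b 0 = 1 ∧ ∀ i ≤ m, 0 < b i := by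
  classical
  have := Fintype.ofFinite V
  obtain ⟨⟨f⟩, hmax⟩ := hm
  -- Any base vertex would do; this one also shows that V is nonempty.
  let o : V := f fun _ => false
  have : Nonempty V := ⟨o⟩
  have hM := hG.metricMedian
  let d : V → ℕ := fun v => (CubePolynomial.MetricMedian.down G o v).card
  have hd : ∀ v, d v ≤ m := fun v => by
    obtain ⟨g, -⟩ := hM.exists_embedding
      (Finset.Subset.refl (CubePolynomial.MetricMedian.down G o v))
    exact hmax ⟨g⟩
  refine ⟨fun i => ((Finset.univ.filter fun v => d v = i).card : ℤ), ?_, ?_, fun i hi => ?_⟩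
  · rw [hM.cubePoly_eq_sum o, ← Finset.sum_fiberwise_of_maps_to (g := d)
      (t := Finset.range (m + 1)) fun v _ => Finset.mem_range.mpr (Nat.lt_succ_of_le (hd v))]
    refine Finset.sum_congr rfl fun i _ => ?_
    rw [Finset.sum_congr rfl (g := fun _ => (Polynomial.X + 1) ^ i) fun v hv => by
      rw [← (Finset.mem_filter.mp hv).2]]
    simp
  · have : (Finset.univ.filter fun v => d v = 0) = {o} := by
      ext v
      simp only [Finset.mem_filter, Finset.mem_univ, true_and, Finset.mem_singleton]
      constructor
      · intro h
        by_contra hne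
        exact (Finset.card_pos.mpr (hM.down_nonempty hne)).ne' h
      · rintro rfl
        have := hM.card_down_le_dist o o
        rw [SimpleGraph.dist_self] at this
        exact Nat.le_zero.mp this
    simp [this]
  -- The top of an m-cube has at least m lower neighbours, so the value i is attained.
  · obtain ⟨v, A, hA, hn, -⟩ := hM.exists_cubeSet_eq o f.isoInduceRange.symm
    have hle : i ≤ (CubePolynomial.MetricMedian.down G o v).card :=
      hi.trans (hn ▸ Finset.card_le_card hA)
    obtain ⟨w, hw⟩ := hM.exists_card_down_eq o v hle
    exact Int.natCast_pos.mpr (Finset.card_pos.mpr ⟨w, by simpa [d] using hw⟩)
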